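/- Let $R$ be a commutative noetherian ring, let $I,J$ be ideals of $R$, and let $M$ be a finitely generated $R$-module. For an ideal $\mathfrak a$ of $R$ put $$\operatorname{depth}(\mathfrak a,M)=\inf\{\,i\in\mathbb N_0 \mid H^i_{\mathfrak a}(M)\neq 0\,\}\in\mathbb N_0\cup\{\infty\},$$ where $H^i_{\mathfrak a}(M)=\varinjlim_n \operatorname{Ext}^i_R(R/\mathfrak a^n,M)$ is the $i$-th local cohomology module of $M$ with support in $\mathfrak a$ and $\inf\emptyset=\infty$. Let $\tilde W(I,J)$ be the set of all ideals $\mathfrak a$ of $R$ such that $I^n\subseteq \mathfrak a+J$ for some integer $n\ge 1$, and put $$\operatorname{depth}(I,J,M)=\inf\{\operatorname{depth}(\mathfrak a,M)\mid \mathfrak a\in\tilde W(I,J)\}.$$ Then for every $\mathfrak a\in\tilde W(I,J)$, $$\operatorname{depth}(I,J,M)\le\operatorname{depth}(\mathfrak a,J,M)\le\operatorname{depth}(\mathfrak a,M).$$ In particular $I\in\tilde W(I,J)$, and hence $\operatorname{depth}(I,J,M)\le\operatorname{depth}(I,M)$. -/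

import Mathlib

universe u

/-- `W̃(I, J)`: the set of ideals `a` of `R` with `I ^ n ⊆ a + J` for some `n`. -/
def Wtilde {R : Type u} [CommRing R] (I J : Ideal R) : Set (Ideal R) :=
  {a | ∃ n : ℕ, 1 ≤ n ∧ I ^ n ≤ a + J}

/-- `depth(a, M)`: the least `i` such that the `i`-th local cohomology module of `M` with support
in `a` is non-zero, and `∞` if there is no such `i`. -/
noncomputable def idealDepth {R : Type u} [CommRing R] (a : Ideal R)
    (M : Type u) [AddCommGroup M] [Module R M] : ℕ∞ :=
  ⨅ (i : ℕ) (_ : ¬ CategoryTheory.Limits.IsZero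
    ((localCohomology a i).obj (ModuleCat.of R M))), (i : ℕ∞)

/-- `depth(I, J, M)`: the infimum of `depth(a, M)` over all `a ∈ W̃(I, J)`. -/
noncomputable def pairDepth {R : Type u} [CommRing R] (I J : Ideal R)
    (M : Type u) [AddCommGroup M] [Module R M] : ℕ∞ :=
  ⨅ a ∈ Wtilde I J, idealDepth a M

/-! Only the index sets of the infima matter, nothing about local cohomology. Membership in `Wtilde
· J` is reflexive and transitive, so replacing `I` by `a ∈ Wtilde I J` shrinks the index set, which
raises the infimum, while `a` itself still belongs to it. -/

theorem Ideal.sup_pow_le_pow_sup {R : Type u} [CommRing R] (a J : Ideal R) (m : ℕ) :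
    (a ⊔ J) ^ m ≤ a ^ m ⊔ J := by
  induction m with
  | zero => simp
  | succ m ih =>
    have hJ (b c : Ideal R) : b * J ≤ c ⊔ J := le_sup_of_le_right Ideal.mul_le_right
    rw [pow_succ (a ⊔ J), pow_succ a]
    refine le_trans (Ideal.mul_mono_left ih) ?_
    -- Every term of the expanded product except `a ^ m * a` has a factor `J`.
    rw [Ideal.mul_sup, Ideal.sup_mul, mul_comm J a]
    exact sup_le (sup_le le_sup_left (hJ _ _)) (hJ _ _)

theorem self_mem_Wtilde {R : Type u} [CommRing R] (I J : Ideal R) : I ∈ Wtilde I J :=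
  ⟨1, le_rfl, by rw [pow_one]; exact le_sup_left⟩

theorem Wtilde_subset_of_mem {R : Type u} [CommRing R] {I J a : Ideal R} (ha : a ∈ Wtilde I J) :
    Wtilde a J ⊆ Wtilde I J := by
  obtain ⟨n, hn, hIa⟩ := ha
  rintro b ⟨m, hm, hab⟩
  -- `I ^ (n * m) ≤ (a + J) ^ m ≤ a ^ m + J ≤ b + J`.
  refine ⟨n * m, Nat.mul_pos hn hm, ?_⟩
  rw [pow_mul]
  exact (Ideal.pow_right_mono hIa m).trans
    ((Ideal.sup_pow_le_pow_sup a J m).trans (sup_le hab le_sup_right))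

theorem pairDepth_le_idealDepth {R : Type u} [CommRing R] {I J a : Ideal R}
    (M : Type u) [AddCommGroup M] [Module R M] (ha : a ∈ Wtilde I J) :
    pairDepth I J M ≤ idealDepth a M :=
  iInf₂_le a ha

theorem pairDepth_le_pairDepth {R : Type u} [CommRing R] {I J a : Ideal R}
    (M : Type u) [AddCommGroup M] [Module R M] (ha : a ∈ Wtilde I J) :
    pairDepth I J M ≤ pairDepth a J M :=
  biInf_mono fun _ hb => Wtilde_subset_of_mem ha hb

theorem corollary3p4 {R : Type u} [CommRing R] [IsNoetherianRing R] (I J : Ideal R)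
    (M : Type u) [AddCommGroup M] [Module R M] [Module.Finite R M] :
    (∀ a ∈ Wtilde I J,
      pairDepth I J M ≤ pairDepth a J M ∧ pairDepth a J M ≤ idealDepth a M) ∧
    (I ∈ Wtilde I J ∧ pairDepth I J M ≤ idealDepth I M) :=
  ⟨fun a ha => ⟨pairDepth_le_pairDepth M ha, pairDepth_le_idealDepth M (self_mem_Wtilde a J)⟩,
    self_mem_Wtilde I J, pairDepth_le_idealDepth M (self_mem_Wtilde I J)⟩
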